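/- Let $\mathbb{Z}^2$ denote the graph on the integer points of the plane in which two points are adjacent when they are at Euclidean distance $1$, and let $v_0$ be any vertex of it. In the $(p,q)$-percolation game on $\mathbb{Z}^2$ two players, Maker and Breaker, play in alternating turns, with Maker playing first. Initially all edges are marked as unsafe. On each of her turns Maker marks $p$ unsafe edges as safe, and on each of his turns Breaker deletes $q$ unsafe edges from the graph. Breaker wins if at any time in the game the component containing $v_0$ becomes finite; a winning strategy for Maker is one that ensures that $v_0$ remains in an infinite component indefinitely. Theorem. Let $p$ and $q$ be positive integers. If $p \geq 2q$, then Maker has a winning strategy for the $(p,q)$-percolation game on $\mathbb{Z}^2$. -/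

import Mathlib

/-- The square integer lattice: the graph on `ℤ × ℤ` in which two points are adjacent
exactly when their Euclidean distance is `1` (equivalently, its square is `1`). -/
def squareLattice : SimpleGraph (ℤ × ℤ) where
  Adj v w := (v.1 - w.1) ^ 2 + (v.2 - w.2) ^ 2 = 1
  symm := ⟨fun v w h => by rw [← h]; ring⟩
  loopless := ⟨fun v h => by simp at h⟩

namespace PercolationGame

/-- The list of the rounds completed so far, latest round first. A round is a pair: the set of
edges Maker marked as safe on her turn, and the set of edges Breaker deleted on the turn of his
that follows it. -/
abbrev History (V : Type*) := List (Finset (Sym2 V) × Finset (Sym2 V))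

variable {V : Type*}

/-- The edges that Maker has marked as safe. -/
def safeEdges (h : History V) : Set (Sym2 V) := {e | ∃ r ∈ h, e ∈ r.1}

/-- The edges that Breaker has deleted. -/
def deletedEdges (h : History V) : Set (Sym2 V) := {e | ∃ r ∈ h, e ∈ r.2}

/-- The edges of `G` that have been neither marked as safe nor deleted. -/
def freeEdges (G : SimpleGraph V) (h : History V) : Set (Sym2 V) :=
  G.edgeSet \ (safeEdges h ∪ deletedEdges h)

/-- The set of vertices of the component of `v₀` in the graph that is left once the deleted edges
have been removed from `G`. -/
def component (G : SimpleGraph V) (v₀ : V) (h : History V) : Set V :=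
  ((G.deleteEdges (deletedEdges h)).connectedComponentMk v₀).supp

/-- After the rounds in `h` Maker may mark the edges in `M`: they are `p` free edges. -/
def MakerLegal (G : SimpleGraph V) (p : ℕ) (h : History V) (M : Finset (Sym2 V)) : Prop :=
  M.card = p ∧ (M : Set (Sym2 V)) ⊆ freeEdges G h

/-- After the rounds in `h` and Maker's move `M`, Breaker may delete the edges in `B`: they are `q`
free edges, none of which is in `M`. -/
def BreakerLegal (G : SimpleGraph V) (q : ℕ) (h : History V) (M B : Finset (Sym2 V)) : Prop :=
  B.card = q ∧ (B : Set (Sym2 V)) ⊆ freeEdges G h \ (M : Set (Sym2 V))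

/-- A strategy for Maker prescribes her next move, given everything that has been played. -/
abbrev MakerStrategy (V : Type*) := History V → Finset (Sym2 V)

/-- The histories that can occur if Maker, who starts, follows `σ` and Breaker makes arbitrary
legal moves of `q` edges. -/
inductive Occurs (G : SimpleGraph V) (q : ℕ) (σ : MakerStrategy V) : History V → Prop
  | start : Occurs G q σ []
  | round (h : History V) (B : Finset (Sym2 V)) :
      Occurs G q σ h → BreakerLegal G q h (σ h) B → Occurs G q σ ((σ h, B) :: h)

/-- `σ` is a winning strategy for Maker in the `(p, q)`-percolation game on `(G, v₀)`: whatever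
Breaker does, `σ` always gives Maker a legal move, and the component of `v₀` never becomes finite.
(The component changes only through Breaker's deletions and only shrinks, so it is enough to
look at it at the start and after each of his turns.) -/
def IsWinning (G : SimpleGraph V) (v₀ : V) (p q : ℕ) (σ : MakerStrategy V) : Prop :=
  ∀ h : History V, Occurs G q σ h → MakerLegal G p h (σ h) ∧ (component G v₀ h).Infinite

/-- Maker has a winning strategy for the `(p, q)`-percolation game on `(G, v₀)`. -/
def MakerHasWinningStrategy (G : SimpleGraph V) (v₀ : V) (p q : ℕ) : Prop :=
  ∃ σ : MakerStrategy V, IsWinning G v₀ p q σ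

end PercolationGame

/-! Work in the planar dual, contracting the dual of every deleted edge. Maker first secures a
vertical path of `q` edges from `v₀` upwards. To enclose it, Breaker must join a face below the
strip 0 ≤ y ≤ q to one above it by deleted dual edges. Maker maintains integer levels on the
contracted dual, at most 0 below the strip and at least q + 1 above, differing by at most 1 along
free edges. Then `q` deletions leave one of the q + 1 thresholds m + 1/2 uncrossed
(`exists_threshold`), the two sides stay apart, and a flux count (`infinite_component`) shows that
the component is infinite.

Maker must then restore the invariant at a cost of two edges per deletion
(`Balanced.exists_contraction`). Each class carries at most four free half-edges. When an edge is
contracted, the class farther from the uncrossed threshold absorbs the other, so the bounds below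
and above the strip survive. Of the at most six half-edges left, Maker gives up two. Only the half
in slot 0 follows its class to the new level: it is the source of a level edge whose target half
stays at its level, so a shift by at most 1 is harmless. -/

namespace PercolationGame

/-! ### Contracting edges of a levelled multigraph -/

section Contraction

variable {V E : Type*}

/-- The endpoint at which a half-edge sits: the target for `true`, the source for `false`. -/
def halfEnd (s t : E → V) (η : E × Bool) : V := if η.2 then t η.1 else s η.1

@[simp] lemma halfEnd_true (s t : E → V) (e : E) : halfEnd s t (e, true) = t e := rfl

@[simp] lemma halfEnd_false (s t : E → V) (e : E) : halfEnd s t (e, false) = s e := rfl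

/-- The free edges `Fr` of a multigraph join vertices whose levels differ by at most `1`, and the
free half-edges at each vertex occupy distinct slots among four; slot `0` is reserved for the
source halves of edges between vertices of equal level. -/
structure Balanced (s t : E → V) (l : V → ℤ) (σ : E × Bool → Fin 4) (Fr : Set E) : Prop where
  near : ∀ e ∈ Fr, l (s e) ≤ l (t e) + 1 ∧ l (t e) ≤ l (s e) + 1
  level : ∀ e ∈ Fr, σ (e, false) = 0 → l (s e) = l (t e)
  ne_zero : ∀ e ∈ Fr, σ (e, true) ≠ 0
  inj : ∀ η η' : E × Bool, η.1 ∈ Fr → η'.1 ∈ Fr → halfEnd s t η = halfEnd s t η' →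
    σ η = σ η' → η = η'

lemma Balanced.mono {s t : E → V} {l : V → ℤ} {σ : E × Bool → Fin 4} {A B : Set E}
    (h : Balanced s t l σ A) (hBA : B ⊆ A) : Balanced s t l σ B :=
  ⟨fun e he => h.near e (hBA he), fun e he => h.level e (hBA he),
    fun e he => h.ne_zero e (hBA he), fun η η' hη hη' => h.inj η η' (hBA hη) (hBA hη')⟩

/-- Level `b` lies on the same side of the threshold `m + 1/2` as level `a`, and is at least as
far from it. -/
def Outward (m a b : ℤ) : Prop := (a ≤ m ∧ b ≤ a) ∨ (m < a ∧ a ≤ b)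

/-- The edges of `U` have been contracted, `r` sending each vertex to the representative of its
class, and the half-edges in `X` have been discarded. The half-edges that are left occupy the slots
`τ` of their classes. -/
structure PartialMerge [DecidableEq E] (s t : E → V) (l : V → ℤ) (m : ℤ) (Fr : Set E)
    (U : Finset E) (r : V → V) (τ : E × Bool → Fin 4) (X : Finset (E × Bool)) : Prop where
  away : ∀ v, Outward m (l v) (l (r v))
  merged : ∀ e ∈ U, r (s e) = r (t e)
  card_le : X.card ≤ 2 * U.card
  kept_true : ∀ e ∈ Fr, e ∉ U → (e, true) ∉ X → l (r (t e)) = l (t e) ∧ τ (e, true) ≠ 0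
  kept_false : ∀ e ∈ Fr, e ∉ U → (e, false) ∉ X → l (r (s e)) = l (s e) ∨
    (l (s e) = l (t e) ∧ l (r (s e)) ≤ l (s e) + 1 ∧ l (s e) ≤ l (r (s e)) + 1)
  kept_zero : ∀ e ∈ Fr, e ∉ U → (e, false) ∉ X → τ (e, false) = 0 →
    l (s e) = l (t e) ∧ l (r (s e)) = l (s e)
  inj : ∀ η η' : E × Bool, η.1 ∈ Fr → η'.1 ∈ Fr → η.1 ∉ U → η'.1 ∉ U → η ∉ X → η' ∉ X →
    r (halfEnd s t η) = r (halfEnd s t η') → τ η = τ η' → η = η'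

variable [DecidableEq E] {s t : E → V} {l : V → ℤ} {m : ℤ} {Fr : Set E} {U : Finset E} {r : V → V}
  {τ : E × Bool → Fin 4} {X : Finset (E × Bool)}

/-- When the class of `(e, !b)` is absorbed by that of `(e, b)`, the absorbed half-edges can be
discarded within budget, except for the one in slot `0` if `(e, b)` vacates a slot for it. -/
lemma PartialMerge.exists_discard (h : PartialMerge s t l m Fr U r τ X) {e : E} (heF : e ∈ Fr)
    (heU : e ∉ U) (b : Bool) (hbad : (e, b) ∉ X → (e, !b) ∉ X → τ (e, !b) ≠ 0) :
    ∃ Y : Finset (E × Bool), Y.card ≤ 2 * (insert e U).card ∧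
      ∀ η : E × Bool, η.1 ∈ Fr → η.1 ∉ insert e U → η ∉ Y → η ∉ X ∧
        (r (halfEnd s t η) = r (halfEnd s t (e, !b)) → (e, b) ∉ X ∧ τ η = 0) := by
  classical
  -- The half-edges to discard: all those of the absorbed class, except slot 0 when `(e, b)` still
  -- holds a slot that it can hand over.
  let K : Set (E × Bool) := {η | η.1 ∈ Fr ∧ η.1 ∉ insert e U ∧ η ∉ X ∧
    r (halfEnd s t η) = r (halfEnd s t (e, !b)) ∧ ((e, b) ∉ X → τ η ≠ 0)}
  have hinj : Set.InjOn τ K := by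
    rintro η ⟨h1, h2, h3, h4, -⟩ η' ⟨h1', h2', h3', h4', -⟩ hτ
    rw [Finset.mem_insert, not_or] at h2 h2'
    exact h.inj η η' h1 h1' h2.2 h2'.2 h3 h3' (h4.trans h4'.symm) hτ
  have hfin : K.Finite := Set.Finite.of_finite_image (Set.toFinite _) hinj
  have hslot (T : Finset (Fin 4)) (hT : ∀ η ∈ K, τ η ∈ T) : hfin.toFinset.card ≤ T.card :=
    Finset.card_le_card_of_injOn τ (fun η hη => hT η (by simpa using hη))
      (fun η hη η' hη' => hinj (by simpa using hη) (by simpa using hη'))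
  have hne : (e, b) ≠ (e, !b) := by simp
  have hopp : (e, !b) ∉ X → ∀ η ∈ K, τ η ≠ τ (e, !b) := by
    rintro hX η ⟨h1, h2, h3, h4, -⟩ hτ
    rw [Finset.mem_insert, not_or] at h2
    exact h2.1 (congrArg Prod.fst (h.inj η (e, !b) h1 heF h2.2 heU h3 hX h4 hτ))
  refine ⟨((X.erase (e, b)).erase (e, !b)) ∪ hfin.toFinset, ?_, ?_⟩
  · have hc := h.card_le
    have hu := Finset.card_union_le ((X.erase (e, b)).erase (e, !b)) hfin.toFinset
    rw [Finset.card_insert_of_notMem heU]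
    -- A half of `e` lying in `X` is refunded, since `e` is now contracted; a half outside `X`
    -- excludes one slot from `K`. Either way the net cost is 4 - 2 = 2.
    by_cases h1 : (e, b) ∈ X <;> by_cases h2 : (e, !b) ∈ X
    · have hk := hslot Finset.univ (fun _ _ => Finset.mem_univ _)
      have e1 := Finset.card_erase_add_one h1
      have e2 := Finset.card_erase_add_one (Finset.mem_erase.2 ⟨hne.symm, h2⟩)
      simp only [Finset.card_univ, Fintype.card_fin] at hk
      omega
    · have hk := hslot (Finset.univ.erase (τ (e, !b))) (fun η hη =>
        Finset.mem_erase.2 ⟨hopp h2 η hη, Finset.mem_univ _⟩)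
      have e1 := Finset.card_erase_add_one h1
      have e2 := Finset.card_erase_le (s := X.erase (e, b)) (a := (e, !b))
      simp only [Finset.card_erase_of_mem (Finset.mem_univ _), Finset.card_univ,
        Fintype.card_fin] at hk
      omega
    · have hk := hslot (Finset.univ.erase 0) (fun η hη =>
        Finset.mem_erase.2 ⟨hη.2.2.2.2 h1, Finset.mem_univ _⟩)
      have e1 := Finset.card_erase_le (s := X) (a := (e, b))
      have e2 := Finset.card_erase_add_one (Finset.mem_erase.2 ⟨hne.symm, h2⟩)
      simp only [Finset.card_erase_of_mem (Finset.mem_univ _), Finset.card_univ,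
        Fintype.card_fin] at hk
      omega
    · have hk := hslot ((Finset.univ.erase 0).erase (τ (e, !b))) (fun η hη =>
        Finset.mem_erase.2 ⟨hopp h2 η hη,
          Finset.mem_erase.2 ⟨hη.2.2.2.2 h1, Finset.mem_univ _⟩⟩)
      have e1 := Finset.card_erase_le (s := X) (a := (e, b))
      have e2 := Finset.card_erase_le (s := X.erase (e, b)) (a := (e, !b))
      rw [Finset.card_erase_of_mem (Finset.mem_erase.2 ⟨hbad h1 h2, Finset.mem_univ _⟩),
        Finset.card_erase_of_mem (Finset.mem_univ _), Finset.card_univ, Fintype.card_fin] at hk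
      omega
  · intro η hF hU hY
    simp only [Finset.mem_union, Finset.mem_erase, Set.Finite.mem_toFinset, not_or] at hY
    have hηe : η.1 ≠ e := fun he => hU (he ▸ Finset.mem_insert_self _ _)
    have hX : η ∉ X := fun hX => hY.1
      ⟨fun he => hηe (congrArg Prod.fst he), fun he => hηe (congrArg Prod.fst he), hX⟩
    refine ⟨hX, fun hr => ?_⟩
    by_contra hcon
    exact hY.2 ⟨hF, hU, hX, hr, fun h1 h2 => hcon ⟨h1, h2⟩⟩

/-- Contracting one more edge, the class of `(e, b)` absorbing that of `(e, !b)`. -/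
lemma PartialMerge.merge (h : PartialMerge s t l m Fr U r τ X) {e : E} (heF : e ∈ Fr)
    (heU : e ∉ U) (hnear : l (s e) ≤ l (t e) + 1 ∧ l (t e) ≤ l (s e) + 1)
    (hside : l (s e) ≤ m ↔ l (t e) ≤ m) (b : Bool)
    (hout : Outward m (l (r (halfEnd s t (e, !b)))) (l (r (halfEnd s t (e, b)))))
    (hbad : (e, b) ∉ X → (e, !b) ∉ X → τ (e, !b) ≠ 0) :
    ∃ r' τ' X', PartialMerge s t l m Fr (insert e U) r' τ' X' := by
  classical
  obtain ⟨Y, hYc, hY⟩ := h.exists_discard heF heU b hbad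
  set k := r (halfEnd s t (e, b)) with hk
  set k' := r (halfEnd s t (e, !b)) with hk'
  -- Levels only move outward and `k` is the outer class, so `l k'` is trapped between the old level
  -- of its end of `e` and `l k`.
  have hdist : (e, b) ∉ X → l k ≤ l k' + 1 ∧ l k' ≤ l k + 1 := by
    intro hX
    have as := h.away (s e)
    have at' := h.away (t e)
    cases b
    · have := h.kept_false e heF heU hX
      simp only [halfEnd_false, Bool.not_false, halfEnd_true] at hk hk'
      rw [← hk] at this as
      rw [← hk'] at at'
      unfold Outward at *
      omega
    · have := h.kept_true e heF heU hX
      simp only [halfEnd_false, Bool.not_true, halfEnd_true] at hk hk'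
      rw [← hk] at this at'
      rw [← hk'] at as
      unfold Outward at *
      omega
  have hzero : (e, b) ∉ X → τ (e, b) = 0 → l k = l k' := by
    intro hX h0
    have as := h.away (s e)
    have at' := h.away (t e)
    cases b
    · have := h.kept_zero e heF heU hX h0
      simp only [halfEnd_false, Bool.not_false, halfEnd_true] at hk hk'
      rw [← hk] at this as
      rw [← hk'] at at'
      unfold Outward at *
      omega
    · exact absurd h0 (h.kept_true e heF heU hX).2
  let r' : V → V := fun v => if r v = k' then k else r v
  -- The surviving half-edge of the absorbed class inherits the slot vacated by `(e, b)`.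
  let τ' : E × Bool → Fin 4 := fun η =>
    if r (halfEnd s t η) = k' ∧ (e, b) ∉ X then τ (e, b) else τ η
  have hUins {f : E} (hf : f ∉ insert e U) : f ∉ U := fun h' => hf (Finset.mem_insert_of_mem h')
  have hr'1 {v : V} (hv : r v = k') : r' v = k := if_pos hv
  have hr'2 {v : V} (hv : r v ≠ k') : r' v = r v := if_neg hv
  have hτ'2 {η : E × Bool} (hv : r (halfEnd s t η) ≠ k') : τ' η = τ η :=
    if_neg (fun h' => hv h'.1)
  have hτ'1 {η : E × Bool} (hv : r (halfEnd s t η) = k') (hX : (e, b) ∉ X) : τ' η = τ (e, b) :=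
    if_pos ⟨hv, hX⟩
  refine ⟨r', τ', Y, ⟨?_, ?_, hYc, ?_, ?_, ?_, ?_⟩⟩
  · intro v
    have hv := h.away v
    by_cases hrv : r v = k'
    · rw [hr'1 hrv]
      rw [hrv] at hv
      unfold Outward at *
      omega
    · rwa [hr'2 hrv]
  · intro f hf
    rcases Finset.mem_insert.1 hf with rfl | hf
    · have h1 : r' (halfEnd s t (f, !b)) = k := hr'1 rfl
      have h2 : r' (halfEnd s t (f, b)) = k := by
        by_cases hkk : r (halfEnd s t (f, b)) = k'
        · exact hr'1 hkk
        · exact hr'2 hkk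
      cases b
      · exact h2.trans h1.symm
      · exact h1.trans h2.symm
    · simp only [r', h.merged f hf]
  · intro f hfF hfU hfY
    obtain ⟨hX, hcl⟩ := hY (f, true) hfF hfU hfY
    have hkt := h.kept_true f hfF (hUins hfU) hX
    by_cases hrv : r (t f) = k'
    -- Survivors of the absorbed class sit in slot 0, which no target half occupies: kept target
    -- halves never change level.
    · exact absurd (hcl hrv).2 hkt.2
    · rw [hr'2 hrv, hτ'2 (η := (f, true)) hrv]
      exact hkt
  · intro f hfF hfU hfY
    obtain ⟨hX, hcl⟩ := hY (f, false) hfF hfU hfY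
    by_cases hrv : r (s f) = k'
    · obtain ⟨hX1, h0⟩ := hcl hrv
      have hkz := h.kept_zero f hfF (hUins hfU) hX h0
      have := hdist hX1
      rw [hr'1 hrv]
      rw [hrv] at hkz
      omega
    · rw [hr'2 hrv]
      exact h.kept_false f hfF (hUins hfU) hX
  · intro f hfF hfU hfY h0
    obtain ⟨hX, hcl⟩ := hY (f, false) hfF hfU hfY
    by_cases hrv : r (s f) = k'
    · obtain ⟨hX1, h0'⟩ := hcl hrv
      have hkz := h.kept_zero f hfF (hUins hfU) hX h0'
      rw [hτ'1 (η := (f, false)) hrv hX1] at h0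
      have := hzero hX1 h0
      rw [hr'1 hrv]
      rw [hrv] at hkz
      omega
    · rw [hτ'2 (η := (f, false)) hrv] at h0
      rw [hr'2 hrv]
      exact h.kept_zero f hfF (hUins hfU) hX h0
  · have hmix {η η' : E × Bool} (hF' : η'.1 ∈ Fr) (hU' : η'.1 ∉ insert e U) (hX' : η' ∉ X)
        (hX1 : (e, b) ∉ X) (hr : r (halfEnd s t η) = k') (hr' : r (halfEnd s t η') ≠ k')
        (hrr : r' (halfEnd s t η) = r' (halfEnd s t η')) (hττ : τ' η = τ' η') : False := by
      rw [hr'1 hr, hr'2 hr'] at hrr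
      rw [hτ'1 hr hX1, hτ'2 hr'] at hττ
      have := h.inj (e, b) η' heF hF' heU (hUins hU') hX1 hX' hrr hττ
      exact hU' (this ▸ Finset.mem_insert_self _ _)
    intro η η' hF hF' hU hU' hηY hηY' hrr hττ
    obtain ⟨hX, hcl⟩ := hY η hF hU hηY
    obtain ⟨hX', hcl'⟩ := hY η' hF' hU' hηY'
    by_cases h1 : r (halfEnd s t η) = k' <;> by_cases h2 : r (halfEnd s t η') = k'
    · exact h.inj η η' hF hF' (hUins hU) (hUins hU') hX hX' (h1.trans h2.symm)
        ((hcl h1).2.trans (hcl' h2).2.symm)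
    · exact (hmix hF' hU' hX' (hcl h1).1 h1 h2 hrr hττ).elim
    · exact (hmix hF hU hX (hcl' h2).1 h2 h1 hrr.symm hττ.symm).elim
    · rw [hr'2 h1, hr'2 h2] at hrr
      rw [hτ'2 h1, hτ'2 h2] at hττ
      exact h.inj η η' hF hF' (hUins hU) (hUins hU') hX hX' hrr hττ

lemma Balanced.exists_partialMerge {σ : E × Bool → Fin 4} (h : Balanced s t l σ Fr)
    (U : Finset E) (hU : (U : Set E) ⊆ Fr) (hm : ∀ e ∈ U, l (s e) ≤ m ↔ l (t e) ≤ m) :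
    ∃ r τ X, PartialMerge s t l m Fr U r τ X := by
  induction U using Finset.induction_on with
  | empty =>
    refine ⟨id, σ, ∅, ⟨fun v => ?_, by simp, by simp, fun e he _ _ => ⟨rfl, h.ne_zero e he⟩,
      fun e _ _ _ => Or.inl rfl, fun e he _ _ h0 => ⟨h.level e he h0, rfl⟩,
      fun η η' hη hη' _ _ _ _ => h.inj η η' hη hη'⟩⟩
    unfold Outward
    simp only [id]
    omega
  | insert e U heU ih =>
    rw [Finset.coe_insert, Set.insert_subset_iff] at hU
    obtain ⟨r, τ, X, hP⟩ := ih hU.2 (fun f hf => hm f (Finset.mem_insert_of_mem hf))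
    have hside := hm e (Finset.mem_insert_self _ _)
    have hnear := h.near e hU.1
    have as := hP.away (s e)
    have at' := hP.away (t e)
    -- The source class absorbs in case of a tie. If the target class is strictly farther out, the
    -- source half cannot be a kept one in slot 0 with the target half kept too, as the levels would
    -- then agree.
    by_cases hc : Outward m (l (r (t e))) (l (r (s e)))
    · exact hP.merge hU.1 heU hnear hside false hc
        (fun _ hX => (hP.kept_true e hU.1 heU hX).2)
    · refine hP.merge hU.1 heU hnear hside true ?_ (fun hX hX' h0 => hc ?_)
      · simp only [halfEnd_true, halfEnd_false, Bool.not_true]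
        unfold Outward at *
        omega
      · have h1 := hP.kept_true e hU.1 heU hX
        have h2 := hP.kept_zero e hU.1 heU hX' h0
        unfold Outward at *
        omega

/-- When finitely many free edges `U`, none of which crosses the threshold `m + 1/2`, are
contracted, balance can be restored by giving up at most `2 * U.card` further free edges. -/
theorem Balanced.exists_contraction {σ : E × Bool → Fin 4} (h : Balanced s t l σ Fr)
    (U : Finset E) (hU : (U : Set E) ⊆ Fr) (hm : ∀ e ∈ U, l (s e) ≤ m ↔ l (t e) ≤ m) :
    ∃ (r : V → V) (τ : E × Bool → Fin 4) (M : Finset E), M.card ≤ 2 * U.card ∧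
      (M : Set E) ⊆ Fr \ U ∧ (∀ v, Outward m (l v) (l (r v))) ∧
      (∀ e ∈ U, r (s e) = r (t e)) ∧
      Balanced (fun e => r (s e)) (fun e => r (t e)) l τ ((Fr \ U) \ M) := by
  classical
  obtain ⟨r, τ, X, hP⟩ := h.exists_partialMerge U hU hm
  -- Giving up a half-edge means securing its whole edge; discarded halves of edges already
  -- contracted or not free cost nothing.
  let M : Finset E := (X.image Prod.fst).filter (fun e => e ∈ Fr \ (U : Set E))
  have hX {e : E} (he : e ∈ (Fr \ (U : Set E)) \ M) (b : Bool) : (e, b) ∉ X := fun hb =>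
    he.2 (Finset.mem_coe.2 (Finset.mem_filter.2 ⟨Finset.mem_image_of_mem Prod.fst hb, he.1⟩))
  have hend (η : E × Bool) : halfEnd (fun e => r (s e)) (fun e => r (t e)) η
      = r (halfEnd s t η) := by
    rcases η with ⟨e, _ | _⟩ <;> rfl
  refine ⟨r, τ, M, ?_, ?_, hP.away, hP.merged, ⟨?_, ?_, ?_, ?_⟩⟩
  · exact (Finset.card_filter_le _ _).trans (Finset.card_image_le.trans hP.card_le)
  · intro e he
    exact (Finset.mem_filter.1 (Finset.mem_coe.1 he)).2
  · intro e he
    have h1 := hP.kept_true e he.1.1 he.1.2 (hX he true)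
    have h2 := hP.kept_false e he.1.1 he.1.2 (hX he false)
    have h3 := h.near e he.1.1
    omega
  · intro e he h0
    have h1 := hP.kept_true e he.1.1 he.1.2 (hX he true)
    have h2 := hP.kept_zero e he.1.1 he.1.2 (hX he false) h0
    omega
  · intro e he
    exact (hP.kept_true e he.1.1 he.1.2 (hX he true)).2
  · intro η η' hη hη' hr
    rw [hend, hend] at hr
    exact hP.inj η η' hη.1.1 hη'.1.1 hη.1.2 hη'.1.2 (hX hη η.2) (hX hη' η'.2) hr

end Contraction

/-! ### Planar duality by flux -/

section Lattice

/-- The flux of a dual potential `a` through the cut given by `c` is the same along all columns of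
a strip, when no edge sees a change in both. -/
lemma flux_eq (q : ℕ) (c a : ℤ → ℤ → ℤ)
    (hrow : ∀ x y, (c x y - c (x + 1) y) * (a x y - a x (y + 1)) = 0)
    (hcol : ∀ x y, (c x y - c x (y + 1)) * (a (x - 1) (y + 1) - a x (y + 1)) = 0)
    (hbot : ∀ x, a x 0 = 1) (htop : ∀ x, a x (q + 1) = 0) (n : ℕ) :
    ∑ y ∈ Finset.range (q + 1), c n y * (a n y - a n (y + 1)) =
      ∑ y ∈ Finset.range (q + 1), c 0 y * (a 0 y - a 0 (y + 1)) := by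
  induction n with
  | zero => simp
  | succ n ih =>
    rw [← ih, ← sub_eq_zero, ← Finset.sum_sub_distrib]
    -- Summation by parts: `f` is the flux between neighbouring columns, and it vanishes at both
    -- ends of the strip because `a` is constant there.
    let f : ℕ → ℤ := fun y => c (n + 1) y * (a (n + 1) y - a n y)
    have hterm : ∀ y ∈ Finset.range (q + 1),
        c ((n + 1 : ℕ) : ℤ) y * (a ((n + 1 : ℕ) : ℤ) y - a ((n + 1 : ℕ) : ℤ) (y + 1))
          - c n y * (a n y - a n (y + 1)) = f y - f (y + 1) := by
      intro y _
      have h1 := hrow n y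
      have h2 := hcol (n + 1) y
      simp only [add_sub_cancel_right] at h2
      simp only [f]
      push_cast
      linear_combination -h1 + h2
    rw [Finset.sum_congr rfl hterm, Finset.sum_range_sub']
    simp only [f]
    push_cast
    rw [hbot, hbot, htop, htop]
    ring

/-- The edge of the square lattice, with origin moved to `v₀`, that leads from a point to its
upper (`true`) or right (`false`) neighbour. -/
def latticeEdge (v₀ : ℤ × ℤ) (e : (ℤ × ℤ) × Bool) : Sym2 (ℤ × ℤ) :=
  s(v₀ + e.1, v₀ + (e.1 + if e.2 then (0, 1) else (1, 0)))

/-- The face to the left of a vertical edge or below a horizontal edge; a face is named after its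
top left corner. -/
def dualSource (e : (ℤ × ℤ) × Bool) : ℤ × ℤ := if e.2 then (e.1.1 - 1, e.1.2 + 1) else e.1

/-- The face to the right of a vertical edge or above a horizontal edge. -/
def dualTarget (e : (ℤ × ℤ) × Bool) : ℤ × ℤ := (e.1.1, e.1.2 + 1)

lemma latticeEdge_injective (v₀ : ℤ × ℤ) : Function.Injective (latticeEdge v₀) := by
  rintro ⟨⟨x, y⟩, b⟩ ⟨⟨x', y'⟩, b'⟩ h
  simp only [latticeEdge, Sym2.eq_iff, add_right_inj] at h
  cases b <;> cases b' <;> simp [Prod.ext_iff] at h ⊢ <;> omega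

lemma latticeEdge_mem (v₀ : ℤ × ℤ) (e : (ℤ × ℤ) × Bool) :
    latticeEdge v₀ e ∈ squareLattice.edgeSet := by
  rcases e with ⟨⟨x, y⟩, _ | _⟩ <;> simp [latticeEdge, squareLattice]

/-- If a set of faces contains everything below the strip `0 ≤ y ≤ q`, nothing above it, and no
edge of `D` separates it from its complement, then the deletion of `D` leaves the component of the
left end of the strip infinite. -/
lemma infinite_component (q : ℕ) (v₀ : ℤ × ℤ) (D : Set (Sym2 (ℤ × ℤ))) (a : ℤ × ℤ → ℤ)
    (ha : ∀ e, latticeEdge v₀ e ∈ D → a (dualSource e) = a (dualTarget e))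
    (hbot : ∀ x, a (x, 0) = 1) (htop : ∀ x, a (x, q + 1) = 0)
    (hcolumn : ∀ y : ℕ, y < q → latticeEdge v₀ ((0, y), true) ∉ D) :
    ((squareLattice.deleteEdges D).connectedComponentMk v₀).supp.Infinite := by
  classical
  intro hfin
  set C := ((squareLattice.deleteEdges D).connectedComponentMk v₀).supp with hC
  let c : ℤ → ℤ → ℤ := fun x y => if v₀ + (x, y) ∈ C then 1 else 0
  have hstep (e : (ℤ × ℤ) × Bool) (he : latticeEdge v₀ e ∉ D) :
      v₀ + e.1 ∈ C ↔ v₀ + (e.1 + if e.2 then (0, 1) else (1, 0)) ∈ C := by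
    have hadj : (squareLattice.deleteEdges D).Adj (v₀ + e.1)
        (v₀ + (e.1 + if e.2 then (0, 1) else (1, 0))) :=
      SimpleGraph.deleteEdges_adj.2 ⟨latticeEdge_mem v₀ e, he⟩
    rw [hC, SimpleGraph.ConnectedComponent.mem_supp_iff,
      SimpleGraph.ConnectedComponent.mem_supp_iff,
      SimpleGraph.ConnectedComponent.connectedComponentMk_eq_of_adj hadj]
  have hrow (x y : ℤ) : (c x y - c (x + 1) y) * (a (x, y) - a (x, y + 1)) = 0 := by
    by_cases he : latticeEdge v₀ ((x, y), false) ∈ D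
    · have := ha _ he
      simp only [dualSource, dualTarget, Bool.false_eq_true, if_false] at this
      rw [this, sub_self, mul_zero]
    · have := hstep _ he
      simp only [Bool.false_eq_true, if_false, Prod.mk_add_mk, add_zero] at this
      simp only [c, this, sub_self, zero_mul]
  have hcol (x y : ℤ) :
      (c x y - c x (y + 1)) * (a (x - 1, y + 1) - a (x, y + 1)) = 0 := by
    by_cases he : latticeEdge v₀ ((x, y), true) ∈ D
    · have := ha _ he
      simp only [dualSource, dualTarget, if_true] at this
      rw [this, sub_self, mul_zero]
    · have := hstep _ he
      simp only [if_true, Prod.mk_add_mk, add_zero] at this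
      simp only [c, this, sub_self, zero_mul]
  have hleft : ∀ y : ℕ, y < q + 1 → c 0 y = 1 := by
    intro y
    induction y with
    | zero =>
      intro _
      have : v₀ + ((0, 0) : ℤ × ℤ) ∈ C := by
        have h0 : ((0, 0) : ℤ × ℤ) = 0 := rfl
        rw [h0, add_zero]
        exact SimpleGraph.ConnectedComponent.connectedComponentMk_mem
      simp [c, this]
    | succ y ih =>
      intro hy
      have := hstep _ (hcolumn y (by omega))
      simp only [if_true, Prod.mk_add_mk, add_zero] at this
      rw [← ih (by omega)]
      push_cast
      simp only [c, this]
  -- A finite component misses some column to the right, where the flux is 0; on column 0 it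
  -- telescopes to 1.
  obtain ⟨n, hn⟩ : ∃ n : ℕ, ∀ y, c n y = 0 := by
    have hinj : Function.Injective (fun n : ℕ => v₀.1 + (n : ℤ)) := fun n n' h => by
      simpa using h
    obtain ⟨n, hn⟩ := ((hfin.image Prod.fst).preimage hinj.injOn).exists_notMem
    refine ⟨n, fun y => if_neg fun hmem => hn ⟨_, hmem, rfl⟩⟩
  have hflux := flux_eq q c (fun x y => a (x, y)) hrow hcol hbot htop n
  have h0 : ∑ y ∈ Finset.range (q + 1), c n y * (a (n, y) - a (n, y + 1)) = 0 :=
    Finset.sum_eq_zero fun y _ => by rw [hn, zero_mul]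
  have h1 : ∑ y ∈ Finset.range (q + 1), c 0 y * (a (0, (y : ℤ)) - a (0, (y : ℤ) + 1)) = 1 := by
    have : ∀ y ∈ Finset.range (q + 1), c 0 y * (a (0, (y : ℤ)) - a (0, (y : ℤ) + 1))
        = a (0, (y : ℤ)) - a (0, ((y + 1 : ℕ) : ℤ)) := fun y hy => by
      rw [hleft y (Finset.mem_range.1 hy), one_mul]
      push_cast
      rfl
    rw [Finset.sum_congr rfl this, Finset.sum_range_sub' (fun y : ℕ => a (0, (y : ℤ)))]
    push_cast
    rw [hbot, htop, sub_zero]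
  rw [h0, h1] at hflux
  exact zero_ne_one hflux

/-! ### The invariant and its restoration -/

/-- With the edges in `S` safe and those in `D` deleted, Maker has the left end of the strip
`0 ≤ y ≤ q` secured, and the contraction of the deleted dual edges admits a balanced level
function that rises from `0` below the strip to `q + 1` above it. -/
structure Secure (q : ℕ) (v₀ : ℤ × ℤ) (S D : Set (Sym2 (ℤ × ℤ))) : Prop where
  column : ∀ y : ℕ, y < q → latticeEdge v₀ ((0, y), true) ∈ S
  levels : ∃ (c : ℤ × ℤ → ℤ × ℤ) (l : ℤ × ℤ → ℤ) (σ : ((ℤ × ℤ) × Bool) × Bool → Fin 4),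
    (∀ e, latticeEdge v₀ e ∈ D → c (dualSource e) = c (dualTarget e)) ∧
    (∀ x y, y ≤ 0 → l (c (x, y)) ≤ 0) ∧ (∀ x y, (q : ℤ) + 1 ≤ y → (q : ℤ) + 1 ≤ l (c (x, y))) ∧
    Balanced (fun e => c (dualSource e)) (fun e => c (dualTarget e)) l σ
      {e | latticeEdge v₀ e ∉ S ∪ D}

lemma secure_start (q : ℕ) (v₀ : ℤ × ℤ) {S : Set (Sym2 (ℤ × ℤ))}
    (hS : ∀ y : ℕ, y < q → latticeEdge v₀ ((0, y), true) ∈ S) : Secure q v₀ S ∅ := by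
  -- The level is the height of a face. Slot 0 goes to the left face of each vertical edge, whose
  -- dual is horizontal and hence level.
  refine ⟨hS, id, Prod.snd, fun η => if η.1.2 then (if η.2 then 1 else 0) else
    (if η.2 then 2 else 3), by simp, fun x y hy => hy, fun x y hy => hy, ⟨?_, ?_, ?_, ?_⟩⟩
  · rintro ⟨⟨x, y⟩, _ | _⟩ - <;> simp [dualSource, dualTarget, add_assoc]
  · rintro ⟨⟨x, y⟩, _ | _⟩ - <;> simp [dualSource, dualTarget]
  · rintro ⟨⟨x, y⟩, _ | _⟩ - <;> simp
  · rintro ⟨⟨⟨x, y⟩, _ | _⟩, _ | _⟩ ⟨⟨⟨x', y'⟩, _ | _⟩, _ | _⟩ - - <;>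
      simp [dualSource, dualTarget, halfEnd]

/-- Among `q + 1` thresholds one is not crossed by any of `q` edges. -/
lemma exists_threshold {E : Type*} (q : ℕ) (f g : E → ℤ) (U : Finset E) (hU : U.card ≤ q)
    (hnear : ∀ e ∈ U, f e ≤ g e + 1 ∧ g e ≤ f e + 1) :
    ∃ m : ℤ, 0 ≤ m ∧ m ≤ q ∧ ∀ e ∈ U, f e ≤ m ↔ g e ≤ m := by
  obtain ⟨m, hm, hmU⟩ := Finset.exists_mem_notMem_of_card_lt_card
    (s := U.image fun e => min (f e) (g e)) (t := Finset.Icc (0 : ℤ) q)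
    (lt_of_le_of_lt (Finset.card_image_le.trans hU) (by simp))
  rw [Finset.mem_Icc] at hm
  refine ⟨m, hm.1, hm.2, fun e he => ?_⟩
  -- An edge with levels at most 1 apart can cross only the threshold just above its lower end.
  have h1 : min (f e) (g e) ≠ m := fun h => hmU (Finset.mem_image.2 ⟨e, he, h⟩)
  have h2 := hnear e he
  omega

lemma Secure.respond {q : ℕ} {v₀ : ℤ × ℤ} {S D : Set (Sym2 (ℤ × ℤ))} (h : Secure q v₀ S D)
    (B : Finset (Sym2 (ℤ × ℤ))) (hB : B.card ≤ q) (hBSD : Disjoint (B : Set (Sym2 (ℤ × ℤ))) (S ∪ D))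
    (hSD : Disjoint S D) :
    ((squareLattice.deleteEdges (D ∪ B)).connectedComponentMk v₀).supp.Infinite ∧
    ∃ M : Finset (Sym2 (ℤ × ℤ)), M.card ≤ 2 * q ∧
      (M : Set (Sym2 (ℤ × ℤ))) ⊆ squareLattice.edgeSet \ (S ∪ (D ∪ B)) ∧
      ∀ S' : Set (Sym2 (ℤ × ℤ)), S ⊆ S' → (M : Set (Sym2 (ℤ × ℤ))) ⊆ S' →
        Secure q v₀ S' (D ∪ B) := by
  classical
  obtain ⟨hcolumn, c, l, σ, hD, hbot, htop, hbal⟩ := h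
  let U : Finset ((ℤ × ℤ) × Bool) := B.preimage (latticeEdge v₀) (latticeEdge_injective v₀).injOn
  have hUmem (e) : e ∈ U ↔ latticeEdge v₀ e ∈ B := by simp [U]
  have hUc : U.card ≤ q :=
    (Finset.card_le_card_of_injOn (latticeEdge v₀) (fun e he => (hUmem e).1 he)
      (latticeEdge_injective v₀).injOn).trans hB
  have hUF : (U : Set ((ℤ × ℤ) × Bool)) ⊆ {e | latticeEdge v₀ e ∉ S ∪ D} := fun e he =>
    Set.disjoint_left.1 hBSD ((hUmem e).1 he)
  obtain ⟨m, hm0, hmq, hm⟩ := exists_threshold q (fun e => l (c (dualSource e)))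
    (fun e => l (c (dualTarget e))) U hUc (fun e he => hbal.near e (hUF he))
  constructor
  -- The separating set consists of the faces whose class lies below the uncrossed threshold.
  · refine infinite_component q v₀ (D ∪ B) (fun f => if l (c f) ≤ m then 1 else 0) ?_ ?_ ?_ ?_
    · rintro e (he | he)
      · simp only [hD e he]
      · simp only [hm e ((hUmem e).2 he)]
    · exact fun x => if_pos ((hbot x 0 le_rfl).trans hm0)
    · intro x
      have := htop x (q + 1) le_rfl
      exact if_neg (by omega)
    · rintro y hy (hmem | hmem)
      · exact Set.disjoint_left.1 hSD (hcolumn y hy) hmem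
      · exact Set.disjoint_left.1 hBSD hmem (Or.inl (hcolumn y hy))
  · obtain ⟨r, τ, M, hMc, hMF, hr, hrU, hbal'⟩ := hbal.exists_contraction U hUF hm
    refine ⟨M.image (latticeEdge v₀), Finset.card_image_le.trans (by omega), ?_, ?_⟩
    · intro f hf
      obtain ⟨e, he, rfl⟩ := Finset.mem_image.1 (Finset.mem_coe.1 hf)
      obtain ⟨h1, h2⟩ := hMF he
      refine ⟨latticeEdge_mem v₀ e, ?_⟩
      rintro (h3 | h3 | h3)
      · exact h1 (Or.inl h3)
      · exact h1 (Or.inr h3)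
      · exact h2 ((hUmem e).2 h3)
    · intro S' hSS' hMS'
      refine ⟨fun y hy => hSS' (hcolumn y hy), fun f => r (c f), l, τ, ?_, ?_, ?_, ?_⟩
      · rintro e (he | he)
        · simp only [hD e he]
        · exact hrU e ((hUmem e).2 he)
      · intro x y hy
        have h1 := hbot x y hy
        have h2 := hr (c (x, y))
        unfold Outward at h2
        dsimp only
        omega
      · intro x y hy
        have h1 := htop x y hy
        have h2 := hr (c (x, y))
        unfold Outward at h2
        dsimp only
        omega
      · refine hbal'.mono fun e he => ⟨⟨?_, fun h1 => ?_⟩, fun h1 => ?_⟩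
        · rintro (h1 | h1)
          · exact he (Or.inl (hSS' h1))
          · exact he (Or.inr (Or.inl h1))
        · exact he (Or.inr (Or.inr ((hUmem e).1 h1)))
        · exact he (Or.inl (hMS' (Finset.mem_coe.2 (Finset.mem_image_of_mem _ h1))))

end Lattice

/-! ### Bookkeeping of positions -/

section Game

variable {V : Type*}

lemma safeEdges_cons (M B : Finset (Sym2 V)) (h : History V) :
    safeEdges ((M, B) :: h) = safeEdges h ∪ M := by
  ext e
  simp [safeEdges, or_comm]

lemma deletedEdges_cons (M B : Finset (Sym2 V)) (h : History V) :
    deletedEdges ((M, B) :: h) = deletedEdges h ∪ B := by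
  ext e
  simp [deletedEdges, or_comm]

lemma finite_safeEdges (h : History V) : (safeEdges h).Finite := by
  induction h with
  | nil => simp [safeEdges]
  | cons r h ih =>
    obtain ⟨M, B⟩ := r
    rw [safeEdges_cons]
    exact ih.union M.finite_toSet

lemma finite_deletedEdges (h : History V) : (deletedEdges h).Finite := by
  induction h with
  | nil => simp [deletedEdges]
  | cons r h ih =>
    obtain ⟨M, B⟩ := r
    rw [deletedEdges_cons]
    exact ih.union B.finite_toSet

/-- Only finitely many edges are ever used up, so a move that is too small can be padded; extra safe
edges never hurt Maker. -/
lemma exists_makerLegal_superset {G : SimpleGraph V} (hG : G.edgeSet.Infinite) {p : ℕ}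
    (h : History V) {M : Finset (Sym2 V)} (hM : (M : Set (Sym2 V)) ⊆ freeEdges G h)
    (hp : M.card ≤ p) : ∃ M', M ⊆ M' ∧ MakerLegal G p h M' := by
  have hinf : (freeEdges G h).Infinite :=
    hG.sdiff ((finite_safeEdges h).union (finite_deletedEdges h))
  classical
  obtain ⟨T, hT, hTc⟩ := (hinf.sdiff M.finite_toSet).exists_subset_card_eq (p - M.card)
  have hdisj : Disjoint M T := Finset.disjoint_left.2 fun e he heT => (hT heT).2 he
  refine ⟨M ∪ T, Finset.subset_union_left, ?_, ?_⟩
  · rw [Finset.card_union_of_disjoint hdisj]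
    omega
  · rw [Finset.coe_union]
    exact Set.union_subset hM fun e he => (hT he).1

end Game

/-! ### Maker's strategy -/

section Strategy

lemma infinite_edgeSet_squareLattice : squareLattice.edgeSet.Infinite :=
  (Set.infinite_range_of_injective (latticeEdge_injective 0)).mono
    (Set.range_subset_iff.2 (latticeEdge_mem 0))

/-- A legal move of Maker after which her position is secure. -/
def SecuringMove (p q : ℕ) (v₀ : ℤ × ℤ) (h : History (ℤ × ℤ)) (M : Finset (Sym2 (ℤ × ℤ))) : Prop :=
  MakerLegal squareLattice p h M ∧ Secure q v₀ (safeEdges h ∪ M) (deletedEdges h)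

lemma exists_securingMove_start {p q : ℕ} (hpq : 2 * q ≤ p) (v₀ : ℤ × ℤ) :
    ∃ M, SecuringMove p q v₀ [] M := by
  classical
  let M : Finset (Sym2 (ℤ × ℤ)) :=
    (Finset.range q).image fun y : ℕ => latticeEdge v₀ ((0, (y : ℤ)), true)
  have hMc : M.card ≤ p := by
    have : M.card ≤ _ := Finset.card_image_le
    rw [Finset.card_range] at this
    omega
  have hM : (M : Set (Sym2 (ℤ × ℤ))) ⊆ freeEdges squareLattice [] := by
    intro e he
    obtain ⟨y, -, rfl⟩ := Finset.mem_image.1 (Finset.mem_coe.1 he)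
    exact ⟨latticeEdge_mem _ _, by simp [safeEdges, deletedEdges]⟩
  obtain ⟨M', hMM', hlegal⟩ := exists_makerLegal_superset infinite_edgeSet_squareLattice [] hM hMc
  refine ⟨M', hlegal, ?_⟩
  have hD : deletedEdges ([] : History (ℤ × ℤ)) = ∅ := by simp [deletedEdges]
  rw [hD]
  exact secure_start q v₀ fun y hy => Or.inr
    (hMM' (Finset.mem_image_of_mem _ (Finset.mem_range.2 hy)))

lemma SecuringMove.exists_next {p q : ℕ} (hpq : 2 * q ≤ p) {v₀ : ℤ × ℤ} {h : History (ℤ × ℤ)}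
    {M B : Finset (Sym2 (ℤ × ℤ))} (hM : SecuringMove p q v₀ h M)
    (hB : BreakerLegal squareLattice q h M B)
    (hdisj : Disjoint (safeEdges h) (deletedEdges h)) :
    Disjoint (safeEdges ((M, B) :: h)) (deletedEdges ((M, B) :: h)) ∧
      (component squareLattice v₀ ((M, B) :: h)).Infinite ∧
      ∃ M', SecuringMove p q v₀ ((M, B) :: h) M' := by
  have hSD : Disjoint (safeEdges h ∪ M) (deletedEdges h) :=
    Set.disjoint_union_left.2 ⟨hdisj, Set.disjoint_left.2 fun e he heD => (hM.1.2 he).2 (Or.inr heD)⟩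
  have hBSD : Disjoint (B : Set (Sym2 (ℤ × ℤ))) (safeEdges h ∪ M ∪ deletedEdges h) := by
    refine Set.disjoint_left.2 fun e he => ?_
    have h1 := hB.2 he
    rintro ((h2 | h2) | h2)
    · exact h1.1.2 (Or.inl h2)
    · exact h1.2 h2
    · exact h1.1.2 (Or.inr h2)
  obtain ⟨hinf, N, hNc, hNfree, hN⟩ := hM.2.respond B hB.1.le hBSD hSD
  rw [← safeEdges_cons M B, ← deletedEdges_cons M B] at hNfree
  obtain ⟨M', hNM', hlegal⟩ := exists_makerLegal_superset infinite_edgeSet_squareLattice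
    ((M, B) :: h) hNfree (hNc.trans hpq)
  refine ⟨?_, ?_, M', hlegal, ?_⟩
  · rw [safeEdges_cons, deletedEdges_cons]
    exact Set.disjoint_union_right.2 ⟨hSD, (hBSD.mono_right Set.subset_union_left).symm⟩
  · rw [component, deletedEdges_cons]
    exact hinf
  · rw [safeEdges_cons, deletedEdges_cons]
    exact hN _ Set.subset_union_left fun e he => Or.inr (hNM' he)

lemma infinite_component_start (v₀ : ℤ × ℤ) : (component squareLattice v₀ []).Infinite := by
  have hD : deletedEdges ([] : History (ℤ × ℤ)) = ∅ := by simp [deletedEdges]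
  rw [component, hD]
  exact infinite_component 0 v₀ ∅ (fun f => if f.2 ≤ 0 then 1 else 0) (by simp) (by simp) (by simp)
    (by simp)

end Strategy

end PercolationGame

open PercolationGame in
theorem theorem2 (p q : ℕ) (hp : 0 < p) (hq : 0 < q) (hpq : 2 * q ≤ p) (v₀ : ℤ × ℤ) :
    PercolationGame.MakerHasWinningStrategy squareLattice v₀ p q := by
  classical
  let σ : MakerStrategy (ℤ × ℤ) := fun h =>
    -- The default `∅` is never played: `key` provides a securing move after every history that
    -- occurs.
    if hM : ∃ M, SecuringMove p q v₀ h M then hM.choose else ∅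
  have hσ (h : History (ℤ × ℤ)) (hM : ∃ M, SecuringMove p q v₀ h M) :
      SecuringMove p q v₀ h (σ h) := by
    simp only [σ, dif_pos hM]
    exact hM.choose_spec
  have key (h : History (ℤ × ℤ)) (ho : Occurs squareLattice q σ h) :
      Disjoint (safeEdges h) (deletedEdges h) ∧ (component squareLattice v₀ h).Infinite ∧
        ∃ M, SecuringMove p q v₀ h M := by
    induction ho with
    | start =>
      exact ⟨by simp [safeEdges], infinite_component_start v₀, exists_securingMove_start hpq v₀⟩
    | round h B ho hB ih => exact (hσ h ih.2.2).exists_next hpq hB ih.1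
  exact ⟨σ, fun h ho => ⟨(hσ h (key h ho).2.2).1, (key h ho).2.1⟩⟩
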